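/- Let $k$ be an algebraically closed field and let $A=\bigoplus_{n\ge 0}A_n$ be a standard graded $k$-algebra (that is, $A\neq 0$, $A_0=k$, $\dim_k A_1<\infty$ and $A$ is generated by $A_1$) of Krull dimension $d$. A *reduction* of $A$ is an ideal $Q$ of $A$ generated by linear forms such that $Q_n=A_n$ for all large $n$, where $Q_n=Q\cap A_n$; it is *minimal* if it is minimal with respect to inclusion among the reductions of $A$. Let $\operatorname{core}(A)$ be the intersection of all reductions of $A$. Let $x_1,\dots,x_m$ be linear forms which span $A_1$. For $\alpha=(\alpha_{ij})\in k^{d\times m}$ let $Q_\alpha\subseteq A$ be the ideal generated by the $d$ linear forms $\alpha_{i1}x_1+\cdots+\alpha_{im}x_m$, $i=1,\dots,d$. Let $u=(u_{ij}\mid i=1,\dots,d,\ j=1,\dots,m)$ be indeterminates, let $z_i=u_{i1}x_1+\cdots+u_{im}x_m$ for $i=1,\dots,d$, and let $Q_u\subseteq A[u]$ be the ideal generated by $z_1,\dots,z_d$. For every $n\ge 0$ put $h_n=\dim_k A_n$ and fix a $k$-basis $\mathcal B_n$ of $A_n$. For $n\ge 1$ let $M_n$ be the matrix over $k[u]$ of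 the coefficients of the elements $z_if$ ($1\le i\le d$, $f\in\mathcal B_{n-1}$) with respect to $\mathcal B_n$. For $t\ge 0$ let $I_t(M_n)$ be the ideal of $k[u]$ generated by the $t$-minors of $M_n$ (with $I_0(M_n)=k[u]$). Put $V_0=k^{d\times m}$ and, for $n\ge 1$, let $V_n\subseteq k^{d\times m}$ be the zero locus of $I_{h_n}(M_n)$. Let $$r:=\max\{n\mid V_n\neq V_{n+1}\}\qquad\text{and}\qquad J:=I_{h_{r+1}}(M_{r+1})\subseteq k[u].$$ Let $Q_u:J^\infty$ be the set of all $f\in A[u]$ such that $fJ^n\subseteq Q_u$ for some positive integer $n$. Suppose that all minimal reductions of $A$ of the form $Q_\alpha$ have the same Hilbert function, that is, $\dim_k(Q_\alpha)_n=\dim_k(Q_\beta)_n$ for all $n\ge 0$ whenever $Q_\alpha$ and $Q_\beta$ are minimal reductions of $A$. Then $$\operatorname{core}(A)=(Q_u:J^\infty)\cap A .$$ -/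

import Mathlib

open MvPolynomial

noncomputable section

namespace GradedCore

section Grading

variable {k A : Type*} [Field k] [CommRing A] [Algebra k A]

/-- `A = ⨁ 𝒜 n` is a standard graded `k`-algebra: it is nonzero, its degree zero part is `k`, its
degree one part has finite dimension, and it is generated by its degree one part. -/
structure IsStandardGraded (𝒜 : ℕ → Submodule k A) [GradedAlgebra 𝒜] : Prop where
  nontrivial : Nontrivial A
  zero_eq : 𝒜 0 = 1
  finite_one : Module.Finite k (𝒜 1)
  adjoin_one : Algebra.adjoin k (𝒜 1 : Set A) = ⊤

/-- A reduction of `A`: an ideal `Q` generated by linear forms with `Q_n = A_n` for all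
large `n`. -/
def IsReduction (𝒜 : ℕ → Submodule k A) (Q : Ideal A) : Prop :=
  (∃ S : Set A, S ⊆ (𝒜 1 : Set A) ∧ Q = Ideal.span S) ∧
    ∃ n₀ : ℕ, ∀ n ≥ n₀, 𝒜 n ≤ Q.restrictScalars k

/-- A minimal reduction of `A`: a reduction that is minimal with respect to inclusion. -/
def IsMinimalReduction (𝒜 : ℕ → Submodule k A) (Q : Ideal A) : Prop :=
  Minimal (IsReduction 𝒜) Q

/-- The (graded) core of `A`: the intersection of all reductions of `A`. -/
def core (𝒜 : ℕ → Submodule k A) : Ideal A :=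
  sInf {Q | IsReduction 𝒜 Q}

/-- The Hilbert function `n ↦ dim_k Q_n` of an ideal `Q`, where `Q_n = Q ∩ A_n`. -/
def hilbertFunction (𝒜 : ℕ → Submodule k A) (Q : Ideal A) (n : ℕ) : ℕ :=
  Module.finrank k (Q.restrictScalars k ⊓ 𝒜 n : Submodule k A)

end Grading

section Minors

variable {R ρ γ : Type*} [CommRing R]

/-- The ideal `I_t(M)` generated by the `t`-minors of the matrix `M`; in particular
`I_0(M) = R`. -/
def minorsIdeal (t : ℕ) (M : Matrix ρ γ R) : Ideal R :=
  Ideal.span {p | ∃ (e : Fin t ↪ ρ) (f : Fin t ↪ γ), p = (M.submatrix e f).det}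

/-- `Q : J^∞`, the ideal of all `f` such that `f J^n ⊆ Q` for some positive integer `n`. -/
def colonInfty (Q J : Ideal R) : Ideal R where
  carrier := {f | ∃ n : ℕ, 0 < n ∧ ∀ g ∈ J ^ n, f * g ∈ Q}
  zero_mem' := ⟨1, one_pos, fun g _ => by simp⟩
  add_mem' := by
    rintro a b ⟨n, hn, ha⟩ ⟨l, _, hb⟩
    refine ⟨n + l, by omega, fun g hg => ?_⟩
    rw [add_mul]
    exact Q.add_mem (ha g (Ideal.pow_le_pow_right (by omega) hg))
      (hb g (Ideal.pow_le_pow_right (by omega) hg))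
  smul_mem' := by
    rintro c a ⟨n, hn, ha⟩
    refine ⟨n, hn, fun g hg => ?_⟩
    rw [smul_eq_mul, mul_assoc]
    exact Q.mul_mem_left c (ha g hg)

end Minors

section Generic

variable {k A : Type*} [Field k] [CommRing A] [Algebra k A]
  (𝒜 : ℕ → Submodule k A) [GradedAlgebra 𝒜] {d m : ℕ} (x : Fin m → 𝒜 1)

/-- The ideal `Q_α` of `A` generated by the `d` linear forms
`y_i = α_{i1} x_1 + ⋯ + α_{im} x_m`. -/
def specialIdeal (α : Fin d × Fin m → k) : Ideal A :=
  Ideal.span (Set.range fun i : Fin d => ∑ j, α (i, j) • (x j : A))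

/-- The generic linear form `z_i = u_{i1} x_1 + ⋯ + u_{im} x_m` in `A[u]`. -/
def genericForm (i : Fin d) : MvPolynomial (Fin d × Fin m) A :=
  ∑ j, X (i, j) * C (x j : A)

variable (d) in
/-- The ideal `Q_u` of `A[u]` generated by the `d` generic linear forms `z_1, …, z_d`. -/
def genericIdeal : Ideal (MvPolynomial (Fin d × Fin m) A) :=
  Ideal.span (Set.range fun i : Fin d => genericForm 𝒜 x i)

/-- The product of a linear form and a form of degree `n`, as a form of degree `n + 1`. -/
def linMul {n : ℕ} (a : 𝒜 1) (b : 𝒜 n) : 𝒜 (n + 1) :=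
  ⟨a * b, add_comm 1 n ▸ SetLike.mul_mem_graded a.2 b.2⟩

/-- A choice of a `k`-basis in every degree, indexed by `Fin h_n` with `h_n = dim_k A_n`. -/
abbrev DegreeBases : Type _ :=
  ∀ n : ℕ, Module.Basis (Fin (Module.finrank k (𝒜 n))) k (𝒜 n)

variable (B : DegreeBases 𝒜)

variable (d) in
/-- The matrix `M_{n+1}` over `k[u]`. Its row of index `(i, b)` consists of the coefficients of
`z_i f_b = ∑_j u_{ij} (x_j f_b)` with respect to the basis of `A_{n+1}`, where `f_b` is the
`b`-th element of the basis of `A_n`. -/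
def multMatrix (n : ℕ) :
    Matrix (Fin d × Fin (Module.finrank k (𝒜 n))) (Fin (Module.finrank k (𝒜 (n + 1))))
      (MvPolynomial (Fin d × Fin m) k) :=
  Matrix.of fun ib c =>
    ∑ j, X (ib.1, j) * C ((B (n + 1)).repr (linMul 𝒜 (x j) (B n ib.2)) c)

/-- The defining property of `multMatrix`: in `A[u]` one has `z_i f_b = ∑_c M_{(i,b),c} g_c`,
where `(f_b)` and `(g_c)` are the bases of `A_n` and `A_{n+1}`. -/
theorem genericForm_mul_eq (n : ℕ) (i : Fin d) (b : Fin (Module.finrank k (𝒜 n))) :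
    genericForm 𝒜 x i * C (B n b : A) =
      ∑ c, MvPolynomial.map (algebraMap k A) (multMatrix 𝒜 d x B n (i, b) c) *
        C (B (n + 1) c : A) := by
  have key : ∀ j, (x j : A) * (B n b : A) =
      ∑ c, algebraMap k A ((B (n + 1)).repr (linMul 𝒜 (x j) (B n b)) c) *
        (B (n + 1) c : A) := by
    intro j
    have h := congrArg (Subtype.val) ((B (n + 1)).sum_repr (linMul 𝒜 (x j) (B n b)))
    simp only [AddSubmonoidClass.coe_finsetSum, Submodule.coe_smul, Algebra.smul_def] at h
    exact h.symm
  simp only [genericForm, multMatrix, Matrix.of_apply, map_sum, map_mul, MvPolynomial.map_X,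
    MvPolynomial.map_C, Finset.sum_mul]
  rw [Finset.sum_comm]
  refine Finset.sum_congr rfl fun j _ => ?_
  rw [mul_assoc, ← C_mul, key, map_sum, Finset.mul_sum]
  refine Finset.sum_congr rfl fun c _ => ?_
  rw [C_mul, mul_assoc]

variable (d) in
/-- The (affine cone over the) variety `V_n`: the zero locus of `I_{h_n}(M_n)`, with `V_0` the
whole space. If `d ≥ 1`, then `h_n ≥ 1` for all `n`, the ideal `I_{h_n}(M_n)` is homogeneous of
positive degree for `n ≥ 1`, and every cone `V_n` contains the origin; so two of these cones agree
if and only if the corresponding subvarieties of projective space agree. -/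
def parameterLocus : ℕ → Set (Fin d × Fin m → k)
  | 0 => Set.univ
  | n + 1 => zeroLocus k
      (minorsIdeal (Module.finrank k (𝒜 (n + 1))) (multMatrix 𝒜 d x B n))

variable (d) in
/-- `r = max {n | V_n ≠ V_{n+1}}`. -/
def lastJump : ℕ :=
  sSup {n | parameterLocus 𝒜 d x B n ≠ parameterLocus 𝒜 d x B (n + 1)}

variable (d) in
/-- The ideal `J = I_{h_{r+1}}(M_{r+1})` of `k[u]`. -/
def jumpIdeal : Ideal (MvPolynomial (Fin d × Fin m) k) :=
  minorsIdeal (Module.finrank k (𝒜 (lastJump 𝒜 d x B + 1)))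
    (multMatrix 𝒜 d x B (lastJump 𝒜 d x B))

end Generic

end GradedCore

end

noncomputable section

namespace GradedCore

section Graded

variable {k A : Type*} [Field k] [CommRing A] [Algebra k A]
  {𝒜 : ℕ → Submodule k A} [GradedAlgebra 𝒜]

theorem IsStandardGraded.eq_pow (hA : IsStandardGraded 𝒜) (n : ℕ) : 𝒜 n = 𝒜 1 ^ n := by
  have hle : ∀ n, 𝒜 1 ^ n ≤ 𝒜 n := by
    intro n
    induction n with
    | zero => rw [pow_zero, hA.zero_eq]
    | succ n ih =>
      rw [pow_succ]
      exact Submodule.mul_le.2 fun a ha b hb => SetLike.mul_mem_graded (ih ha) hb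
  have hmul : ∀ a b : A, a ∈ (⨆ n : ℕ, 𝒜 1 ^ n) → b ∈ (⨆ n : ℕ, 𝒜 1 ^ n) →
      a * b ∈ (⨆ n : ℕ, 𝒜 1 ^ n) := by
    intro a b ha hb
    have : (⨆ n : ℕ, 𝒜 1 ^ n) * (⨆ n : ℕ, 𝒜 1 ^ n) ≤ (⨆ n : ℕ, 𝒜 1 ^ n) := by
      simp only [Submodule.iSup_mul, Submodule.mul_iSup, ← pow_add]
      exact iSup_le fun i => iSup_le fun j => le_iSup (fun n : ℕ => 𝒜 1 ^ n) _
    exact this (Submodule.mul_mem_mul ha hb)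
  have htop : ∀ a : A, a ∈ (⨆ n : ℕ, 𝒜 1 ^ n) := by
    intro a
    have ha : a ∈ Algebra.adjoin k (𝒜 1 : Set A) := hA.adjoin_one ▸ Algebra.mem_top
    induction ha using Algebra.adjoin_induction with
    | mem a ha => exact (le_iSup (fun n : ℕ => 𝒜 1 ^ n) 1) (by simpa using ha)
    | algebraMap c =>
      exact (le_iSup (fun n : ℕ => 𝒜 1 ^ n) 0) (by simp)
    | add a b _ _ ha hb => exact add_mem ha hb
    | mul a b _ _ ha hb => exact hmul a b ha hb
  have hcomp : ∀ a : A, ∀ n, (DirectSum.decompose 𝒜 a n : A) ∈ 𝒜 1 ^ n := by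
    intro a
    refine Submodule.iSup_induction (fun n : ℕ => 𝒜 1 ^ n)
      (motive := fun a => ∀ n, (DirectSum.decompose 𝒜 a n : A) ∈ 𝒜 1 ^ n) (htop a) ?_ ?_ ?_
    · intro i a ha n
      by_cases h : i = n
      · subst h
        rwa [DirectSum.decompose_of_mem_same 𝒜 (hle i ha)]
      · rw [DirectSum.decompose_of_mem_ne 𝒜 (hle i ha) h]
        exact zero_mem _
    · intro n
      simp
    · intro a b ha hb n
      rw [DirectSum.decompose_add]
      exact add_mem (ha n) (hb n)
  refine le_antisymm (fun a ha => ?_) (hle n)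
  rw [← DirectSum.decompose_of_mem_same 𝒜 ha]
  exact hcomp a n

theorem IsStandardGraded.succ_eq (hA : IsStandardGraded 𝒜) (n : ℕ) :
    𝒜 (n + 1) = 𝒜 n * 𝒜 1 := by
  rw [hA.eq_pow (n + 1), hA.eq_pow n, pow_succ]

theorem IsStandardGraded.fg (hA : IsStandardGraded 𝒜) (n : ℕ) : (𝒜 n).FG := by
  rw [hA.eq_pow n]
  exact Submodule.FG.pow (Module.Finite.iff_fg.1 hA.finite_one) n

theorem IsStandardGraded.finite (hA : IsStandardGraded 𝒜) (n : ℕ) : Module.Finite k (𝒜 n) :=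
  Module.Finite.iff_fg.2 (hA.fg n)

theorem exists_sum_mul_of_mem_span {ι : Type*} [Fintype ι] {y : ι → A} (hy : ∀ i, y i ∈ 𝒜 1)
    {n : ℕ} {a : A} (ha : a ∈ 𝒜 (n + 1)) (haQ : a ∈ Ideal.span (Set.range y)) :
    ∃ b : ι → A, (∀ i, b i ∈ 𝒜 n) ∧ a = ∑ i, b i * y i := by
  obtain ⟨c, hc⟩ := Ideal.mem_span_range_iff_exists_fun.1 haQ
  refine ⟨fun i => DirectSum.decompose 𝒜 (c i) n, fun i => SetLike.coe_mem _, ?_⟩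
  rw [← DirectSum.decompose_of_mem_same 𝒜 ha, ← hc, DirectSum.decompose_sum,
    DFinsupp.finsetSum_apply, AddSubmonoidClass.coe_finsetSum]
  exact Finset.sum_congr rfl fun i _ => DirectSum.coe_decompose_mul_add_of_right_mem 𝒜 (hy i)

theorem IsStandardGraded.le_of_le (hA : IsStandardGraded 𝒜) {Q : Ideal A} {n m : ℕ} (hnm : n ≤ m)
    (h : 𝒜 n ≤ Q.restrictScalars k) : 𝒜 m ≤ Q.restrictScalars k := by
  induction m, hnm using Nat.le_induction with
  | base => exact h
  | succ m _ ih =>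
    rw [hA.succ_eq]
    exact Submodule.mul_le.2 fun a ha b _ => Q.mul_mem_right b (ih ha)

theorem IsStandardGraded.isReduction_span_iff (hA : IsStandardGraded 𝒜) {S : Set A}
    (hS : S ⊆ 𝒜 1) :
    IsReduction 𝒜 (Ideal.span S) ↔ ∃ n, 𝒜 n ≤ (Ideal.span S).restrictScalars k :=
  ⟨fun h => ⟨_, h.2.choose_spec _ le_rfl⟩,
    fun ⟨n, hn⟩ => ⟨⟨S, hS, rfl⟩, n, fun _ hm => hA.le_of_le hm hn⟩⟩

theorem IsStandardGraded.isReduction_span_iff_radical (hA : IsStandardGraded 𝒜) {S : Set A}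
    (hS : S ⊆ 𝒜 1) :
    IsReduction 𝒜 (Ideal.span S) ↔ (𝒜 1 : Set A) ⊆ (Ideal.span S).radical := by
  rw [hA.isReduction_span_iff hS]
  constructor
  · rintro ⟨n, hn⟩ a ha
    exact ⟨n, hn (hA.eq_pow n ▸ Submodule.pow_mem_pow _ ha n)⟩
  · intro h
    obtain ⟨F, hF⟩ := hA.fg 1
    have hfg : (Ideal.span (𝒜 1 : Set A)).FG := by
      refine ⟨F, le_antisymm (Ideal.span_mono ?_) (Ideal.span_le.2 fun a ha => ?_)⟩
      · rw [← hF]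
        exact Submodule.subset_span
      · rw [← hF] at ha
        exact Submodule.span_le_restrictScalars k A _ ha
    obtain ⟨N, hN⟩ := Ideal.exists_pow_le_of_le_radical_of_fg (Ideal.span_le.2 h) hfg
    refine ⟨N, fun a ha => hN ?_⟩
    have : ∀ N, 𝒜 1 ^ N ≤ ((Ideal.span (𝒜 1 : Set A)) ^ N).restrictScalars k := by
      intro N
      induction N with
      | zero => simp
      | succ N ih =>
        rw [pow_succ, pow_succ]
        exact Submodule.mul_le.2 fun a ha b hb =>
          Ideal.mul_mem_mul (ih ha) (Ideal.subset_span hb)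
    exact this N (hA.eq_pow N ▸ ha)

theorem IsStandardGraded.finite_aeval (hA : IsStandardGraded 𝒜) {ι : Type*} [Fintype ι] {y : ι → A}
    (hy : ∀ i, y i ∈ 𝒜 1) (hQ : IsReduction 𝒜 (Ideal.span (Set.range y))) :
    (aeval y : MvPolynomial ι k →ₐ[k] A).toRingHom.Finite := by
  obtain ⟨-, n₀, hn₀⟩ := hQ
  classical
  choose F hF using fun n => hA.fg n
  let _ := (aeval y : MvPolynomial ι k →ₐ[k] A).toRingHom.toAlgebra
  have hsmul : ∀ (p : MvPolynomial ι k) (a : A), p • a = aeval y p * a := fun p a => rfl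
  have : IsScalarTower k (MvPolynomial ι k) A := ⟨fun c p a => by
    rw [hsmul, hsmul, map_smul, smul_mul_assoc]⟩
  have hmem : ∀ n, ∀ a ∈ 𝒜 n, a ∈ Submodule.span (MvPolynomial ι k)
      ((Finset.range (n₀ + 1)).biUnion F : Set A) := by
    intro n
    induction n with
    | zero =>
      intro a ha
      rw [← hF 0] at ha
      refine Submodule.span_le_restrictScalars k (MvPolynomial ι k) _
        (Submodule.span_mono ?_ ha)
      intro b hb
      simp only [Finset.coe_biUnion, Set.mem_iUnion]
      exact ⟨0, by simp, hb⟩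
    | succ n ih =>
      intro a ha
      by_cases hn : n + 1 ≤ n₀
      · rw [← hF (n + 1)] at ha
        refine Submodule.span_le_restrictScalars k (MvPolynomial ι k) _
          (Submodule.span_mono ?_ ha)
        intro b hb
        simp only [Finset.coe_biUnion, Set.mem_iUnion]
        exact ⟨n + 1, by simpa using by omega, hb⟩
      · obtain ⟨b, hb, rfl⟩ := exists_sum_mul_of_mem_span hy ha (hn₀ (n + 1) (by omega) ha)
        refine Submodule.sum_mem _ fun i _ => ?_
        have : b i * y i = (X i : MvPolynomial ι k) • b i := by
          rw [hsmul, aeval_X, mul_comm]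
        rw [this]
        exact Submodule.smul_mem _ _ (ih _ (hb i))
  refine ⟨⟨(Finset.range (n₀ + 1)).biUnion F, eq_top_iff.2 fun a _ => ?_⟩⟩
  rw [← DirectSum.sum_support_decompose 𝒜 a]
  exact Submodule.sum_mem _ fun n _ => hmem n _ (SetLike.coe_mem _)

theorem ringKrullDim_le_of_isIntegral {R S : Type*} [CommRing R] [CommRing S] {f : R →+* S}
    (hf : f.IsIntegral) : ringKrullDim S ≤ ringKrullDim R := by
  let _ := f.toAlgebra
  have : Algebra.IsIntegral R S := ⟨hf⟩
  refine Order.krullDim_le_of_strictMono (PrimeSpectrum.comap f) fun P P' h => ?_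
  exact Ideal.IsIntegral.comap_lt_comap (R := R) (I := P.asIdeal) (J := P'.asIdeal) h

theorem ringKrullDim_le_of_isIntegral_of_injective {R S : Type*} [CommRing R] [CommRing S]
    {f : R →+* S} (hf : f.IsIntegral) (hinj : Function.Injective f) :
    ringKrullDim R ≤ ringKrullDim S := by
  let _ := f.toAlgebra
  have : Algebra.IsIntegral R S := ⟨hf⟩
  refine iSup_le fun l => ?_
  obtain ⟨P, -, hP, hPl⟩ := Ideal.exists_ideal_over_prime_of_isIntegral l.head.asIdeal (⊥ : Ideal S)
    (by
      rw [← RingHom.ker_eq_comap_bot]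
      exact ((RingHom.injective_iff_ker_eq_bot f).1 hinj).le.trans bot_le)
  have : P.LiesOver l.head.asIdeal := ⟨hPl.symm⟩
  obtain ⟨L, hL, -⟩ := Ideal.exists_ltSeries_of_hasGoingUp l P
  rw [← hL]
  exact le_iSup (fun L : LTSeries (PrimeSpectrum S) => (L.length : WithBot ℕ∞)) L

theorem IsStandardGraded.ringKrullDim_le (hA : IsStandardGraded 𝒜) {e : ℕ} {y : Fin e → A}
    (hy : ∀ i, y i ∈ 𝒜 1) (hQ : IsReduction 𝒜 (Ideal.span (Set.range y))) :
    ringKrullDim A ≤ e := by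
  have := ringKrullDim_le_of_isIntegral (hA.finite_aeval hy hQ).to_isIntegral
  simpa [ringKrullDim_eq_zero_of_field] using this

theorem IsStandardGraded.exists_aeval_eq_zero (hA : IsStandardGraded 𝒜) {e d : ℕ}
    (hd : ringKrullDim A = d) (hde : d < e) {y : Fin e → A}
    (hy : ∀ i, y i ∈ 𝒜 1) (hQ : IsReduction 𝒜 (Ideal.span (Set.range y))) :
    ∃ F : MvPolynomial (Fin e) k, F ≠ 0 ∧ aeval y F = 0 := by
  by_contra! h
  have hinj : Function.Injective (aeval y : MvPolynomial (Fin e) k →ₐ[k] A).toRingHom :=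
    (injective_iff_map_eq_zero _).2 fun F hF => by
      by_contra h0
      exact h F h0 hF
  have := ringKrullDim_le_of_isIntegral_of_injective (hA.finite_aeval hy hQ).to_isIntegral hinj
  rw [hd] at this
  have h2 : (e : WithBot ℕ∞) ≤ d := by simpa [ringKrullDim_eq_zero_of_field] using this
  have h3 : e ≤ d := by exact_mod_cast h2
  omega

theorem aeval_mem_of_isHomogeneous {ι : Type*} {y : ι → A} (hy : ∀ i, y i ∈ 𝒜 1)
    {F : MvPolynomial ι k} {n : ℕ} (hF : F.IsHomogeneous n) : aeval y F ∈ 𝒜 n := by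
  rw [F.as_sum, map_sum]
  refine Submodule.sum_mem _ fun s hs => ?_
  rw [aeval_monomial, ← Algebra.smul_def]
  refine Submodule.smul_mem _ _ ?_
  have hs' : s.sum (fun _ e => e) = n := by
    have := hF (mem_support_iff.1 hs)
    rw [Finsupp.weight_apply] at this
    simpa using this
  rw [← hs']
  refine SetLike.prod_mem_graded 𝒜 _ _ fun i _ => ?_
  have := SetLike.pow_mem_graded (A := 𝒜) (s i) (hy i)
  simpa using this

theorem exists_isHomogeneous_aeval_eq_zero {ι : Type*} {y : ι → A} (hy : ∀ i, y i ∈ 𝒜 1)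
    {F : MvPolynomial ι k} (hF0 : F ≠ 0) (hF : aeval y F = 0) :
    ∃ (n : ℕ) (G : MvPolynomial ι k), G.IsHomogeneous n ∧ G ≠ 0 ∧ aeval y G = 0 := by
  obtain ⟨n, hn⟩ : ∃ n, homogeneousComponent n F ≠ 0 := by
    by_contra! h
    exact hF0 (by rw [← sum_homogeneousComponent F]; simp [h])
  refine ⟨n, _, homogeneousComponent_isHomogeneous n F, hn, ?_⟩
  have key : ∀ i ∈ Finset.range (F.totalDegree + 1),
      ((DirectSum.decompose 𝒜 (aeval y (homogeneousComponent i F)) n : 𝒜 n) : A) =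
        if i = n then aeval y (homogeneousComponent n F) else 0 := by
    intro i _
    have := aeval_mem_of_isHomogeneous hy (homogeneousComponent_isHomogeneous i F)
    split_ifs with h
    · subst h
      exact DirectSum.decompose_of_mem_same 𝒜 this
    · exact DirectSum.decompose_of_mem_ne 𝒜 this h
  have h0 : ((DirectSum.decompose 𝒜 (aeval y F) n : 𝒜 n) : A) = 0 := by simp [hF]
  rw [← sum_homogeneousComponent F, map_sum, DirectSum.decompose_sum,
    DFinsupp.finsetSum_apply, AddSubmonoidClass.coe_finsetSum, Finset.sum_congr rfl key,
    Finset.sum_ite_eq'] at h0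
  split_ifs at h0 with h
  · exact h0
  · rw [homogeneousComponent_eq_zero _ _ (by simpa using h), map_zero]

theorem aeval_smul_of_isHomogeneous {ι B : Type*} [CommRing B] [Algebra k B]
    {F : MvPolynomial ι k} {n : ℕ} (hF : F.IsHomogeneous n) (c : ι → k) (b : B) :
    aeval (fun j => c j • b) F = eval c F • b ^ n := by
  rw [aeval_def, eval₂_eq, eval_eq, Finset.sum_smul]
  refine Finset.sum_congr rfl fun s hs => ?_
  have hs' : ∑ i ∈ s.support, s i = n := by
    have := hF (mem_support_iff.1 hs)
    rw [Finsupp.weight_apply, Finsupp.sum] at this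
    simpa using this
  simp only [smul_pow, Finset.prod_smul, Finset.prod_pow_eq_pow_sum, hs']
  rw [← Algebra.smul_def, smul_smul]

theorem exists_isReduction_of_succ [Infinite k] (hA : IsStandardGraded 𝒜) {e d : ℕ}
    (hd : ringKrullDim A = d) (hde : d ≤ e) {y : Fin (e + 1) → A}
    (hy : ∀ i, y i ∈ 𝒜 1) (hQ : IsReduction 𝒜 (Ideal.span (Set.range y))) :
    ∃ y' : Fin e → A, (∀ i, y' i ∈ 𝒜 1) ∧
      (∀ i, y' i ∈ Submodule.span k (Set.range y)) ∧
      IsReduction 𝒜 (Ideal.span (Set.range y')) := by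
  obtain ⟨F, hF0, hF⟩ := hA.exists_aeval_eq_zero hd (Nat.lt_succ_of_le hde) hy hQ
  obtain ⟨n, G, hG, hG0, hGy⟩ := exists_isHomogeneous_aeval_eq_zero hy hF0 hF
  obtain ⟨c, hc⟩ : ∃ c, eval c G ≠ 0 := by
    by_contra! h
    exact hG0 (MvPolynomial.funext fun c => by simp [h c])
  have hn : n ≠ 0 := by
    rintro rfl
    have := hA.nontrivial
    obtain ⟨a, rfl⟩ : ∃ a, G = C a := ⟨_, (totalDegree_eq_zero_iff_eq_C.1 (by
      simpa using hG.totalDegree_le))⟩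
    rw [aeval_C] at hGy
    rw [eval_C] at hc
    exact hc ((map_eq_zero _).1 hGy)
  obtain ⟨i, hi⟩ : ∃ i, c i ≠ 0 := by
    by_contra! h
    obtain rfl : c = 0 := _root_.funext h
    exact hc (by simpa [hn, Pi.zero_def, coe_aeval_eq_eval] using
      aeval_smul_of_isHomogeneous hG (0 : Fin (e + 1) → k) (0 : k))
  have hy1 : ∀ j, y j - (c j / c i) • y i ∈ 𝒜 1 := fun j =>
    sub_mem (hy j) (Submodule.smul_mem _ _ (hy i))
  refine ⟨fun j => y (i.succAbove j) - (c (i.succAbove j) / c i) • y i, fun j => hy1 _,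
    fun j => sub_mem (Submodule.subset_span ⟨_, rfl⟩)
      (Submodule.smul_mem _ _ (Submodule.subset_span ⟨_, rfl⟩)), ?_⟩
  set Q' := Ideal.span (Set.range fun j : Fin e =>
    y (i.succAbove j) - (c (i.succAbove j) / c i) • y i) with hQ'
  have hmem : ∀ j, y j - (c j / c i) • y i ∈ Q' := by
    intro j
    rcases Fin.eq_self_or_eq_succAbove i j with rfl | ⟨j, rfl⟩
    · simp [div_self hi]
    · exact Ideal.subset_span ⟨j, rfl⟩
  have hi' : y i ∈ Q'.radical := by
    refine ⟨n, ?_⟩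
    rw [← Ideal.Quotient.eq_zero_iff_mem]
    have h1 : ∀ j, Ideal.Quotient.mkₐ k Q' (y j) =
        (c j / c i) • Ideal.Quotient.mkₐ k Q' (y i) := by
      intro j
      rw [← map_smul, ← sub_eq_zero, ← map_sub]
      exact Ideal.Quotient.eq_zero_iff_mem.2 (hmem j)
    have h2 : aeval (fun j => Ideal.Quotient.mkₐ k Q' (y j)) G = 0 := by
      rw [← comp_aeval_apply, hGy, map_zero]
    rw [_root_.funext h1, aeval_smul_of_isHomogeneous hG, ← map_pow, ← map_smul] at h2
    have h3 : eval (fun j => c j / c i) G ≠ 0 := by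
      have := aeval_smul_of_isHomogeneous hG c (c i)⁻¹
      simp only [smul_eq_mul, ← div_eq_mul_inv] at this
      rw [← coe_aeval_eq_eval]
      exact this.trans_ne (mul_ne_zero hc (pow_ne_zero _ (inv_ne_zero hi)))
    rw [map_smul] at h2
    exact (smul_eq_zero_iff_right h3).1 h2
  rw [hQ', hA.isReduction_span_iff_radical (by rintro _ ⟨j, rfl⟩; exact hy1 _), ← hQ']
  rw [hA.isReduction_span_iff_radical (by rintro _ ⟨j, rfl⟩; exact hy _)] at hQ
  have : (Ideal.span (Set.range y)).radical ≤ Q'.radical := by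
    rw [Ideal.radical_le_radical_iff, Ideal.span_le]
    rintro _ ⟨j, rfl⟩
    have := add_mem (Ideal.le_radical (hmem j)) (Q'.radical.restrictScalars k |>.smul_mem (c j / c i) hi')
    simpa using this
  exact hQ.trans this

theorem IsStandardGraded.exists_isReduction_fin [Infinite k] (hA : IsStandardGraded 𝒜) {d : ℕ}
    (hd : ringKrullDim A = d) {M : ℕ} {y : Fin M → A} (hy : ∀ i, y i ∈ 𝒜 1)
    (hQ : IsReduction 𝒜 (Ideal.span (Set.range y))) :
    ∃ y' : Fin d → A, (∀ i, y' i ∈ 𝒜 1) ∧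
      (∀ i, y' i ∈ Submodule.span k (Set.range y)) ∧
      IsReduction 𝒜 (Ideal.span (Set.range y')) := by
  have hpad : ∀ {M : ℕ} {y : Fin M → A}, M ≤ d → (∀ i, y i ∈ 𝒜 1) →
      IsReduction 𝒜 (Ideal.span (Set.range y)) → ∃ y' : Fin d → A, (∀ i, y' i ∈ 𝒜 1) ∧
      (∀ i, y' i ∈ Submodule.span k (Set.range y)) ∧
      IsReduction 𝒜 (Ideal.span (Set.range y')) := by
    intro M y hM hy hQ
    have hmem : ∀ i : Fin d, (if h : (i : ℕ) < M then y ⟨i, h⟩ else 0) ∈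
        Submodule.span k (Set.range y) := by
      intro i
      split_ifs
      exacts [Submodule.subset_span ⟨_, rfl⟩, zero_mem _]
    have hle : Submodule.span k (Set.range y) ≤ 𝒜 1 :=
      Submodule.span_le.2 (by rintro _ ⟨i, rfl⟩; exact hy i)
    refine ⟨fun i => if h : (i : ℕ) < M then y ⟨i, h⟩ else 0, fun i => hle (hmem i), hmem, ?_⟩
    convert hQ using 1
    refine le_antisymm (Ideal.span_le.2 ?_) (Ideal.span_le.2 ?_)
    · rintro _ ⟨i, rfl⟩
      exact Submodule.span_le_restrictScalars k A _ (hmem i)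
    · rintro _ ⟨i, rfl⟩
      exact Ideal.subset_span ⟨⟨i, i.2.trans_le hM⟩, by simp⟩
  induction M with
  | zero => exact hpad (Nat.zero_le d) hy hQ
  | succ e ih =>
    by_cases h : e + 1 ≤ d
    · exact hpad h hy hQ
    · obtain ⟨y₁, h1, h2, h3⟩ := exists_isReduction_of_succ hA hd (by omega) hy hQ
      obtain ⟨y₂, h4, h5, h6⟩ := ih h1 h3
      refine ⟨y₂, h4, fun i => ?_, h6⟩
      exact (Submodule.span_le.2 (by rintro _ ⟨i, rfl⟩; exact h2 i)) (h5 i)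

theorem ideal_span_eq_of_span_eq {S T : Set A} (h : Submodule.span k S = Submodule.span k T) :
    Ideal.span S = Ideal.span T := by
  refine le_antisymm (Ideal.span_le.2 fun a ha => ?_) (Ideal.span_le.2 fun a ha => ?_) <;>
    refine Submodule.span_le_restrictScalars k A _ ?_
  · exact h ▸ Submodule.subset_span ha
  · exact h ▸ Submodule.subset_span ha

/-- Over an infinite field, every subset of the linear forms that generates a reduction has `d`
linear combinations that generate a reduction, where `d` is the Krull dimension. -/
theorem IsStandardGraded.exists_isReduction [Infinite k] (hA : IsStandardGraded 𝒜) {d : ℕ}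
    (hd : ringKrullDim A = d) {S : Set A} (hS : S ⊆ 𝒜 1) (hQ : IsReduction 𝒜 (Ideal.span S)) :
    ∃ y : Fin d → A, (∀ i, y i ∈ 𝒜 1) ∧ (∀ i, y i ∈ Submodule.span k S) ∧
      IsReduction 𝒜 (Ideal.span (Set.range y)) := by
  have hle : Submodule.span k S ≤ 𝒜 1 := Submodule.span_le.2 hS
  have := hA.finite 1
  have := Submodule.finiteDimensional_of_le hle
  obtain ⟨f, hfS, hf, -⟩ := Submodule.exists_fun_fin_finrank_span_eq k S
  rw [← ideal_span_eq_of_span_eq hf] at hQ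
  rw [← hf]
  exact hA.exists_isReduction_fin hd (fun i => hS (hfS i)) hQ

/-- The linear forms generating a reduction are linearly independent if there are at most as many
as the Krull dimension. -/
theorem IsStandardGraded.linearIndependent (hA : IsStandardGraded 𝒜) {d : ℕ}
    (hd : ringKrullDim A = d) {y : Fin d → A} (hy : ∀ i, y i ∈ 𝒜 1)
    (hQ : IsReduction 𝒜 (Ideal.span (Set.range y))) : LinearIndependent k y := by
  rw [linearIndependent_iff_card_le_finrank_span, Fintype.card_fin]
  have := FiniteDimensional.span_of_finite k (Set.finite_range y)
  obtain ⟨f, hfS, hf, -⟩ := Submodule.exists_fun_fin_finrank_span_eq k (Set.range y)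
  rw [← ideal_span_eq_of_span_eq hf] at hQ
  have hf1 : ∀ i, f i ∈ 𝒜 1 := fun i => by
    obtain ⟨j, hj⟩ := hfS i
    exact hj ▸ hy j
  have := hA.ringKrullDim_le hf1 hQ
  rw [hd] at this
  exact_mod_cast this

theorem mem_span_of_mem_ideal_span (hA : IsStandardGraded 𝒜) {ι : Type*} [Fintype ι]
    {y : ι → A} (hy : ∀ i, y i ∈ 𝒜 1) {a : A} (ha : a ∈ 𝒜 1)
    (haQ : a ∈ Ideal.span (Set.range y)) : a ∈ Submodule.span k (Set.range y) := by
  obtain ⟨b, hb, rfl⟩ := exists_sum_mul_of_mem_span (n := 0) hy ha haQ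
  refine Submodule.sum_mem _ fun i _ => ?_
  have := hb i
  rw [hA.zero_eq, Submodule.mem_one] at this
  obtain ⟨c, hc⟩ := this
  rw [← hc, ← Algebra.smul_def]
  exact Submodule.smul_mem _ _ (Submodule.subset_span ⟨i, rfl⟩)

/-- A reduction generated by as many linear forms as the Krull dimension is minimal. -/
theorem IsStandardGraded.isMinimalReduction [Infinite k] (hA : IsStandardGraded 𝒜) {d : ℕ}
    (hd : ringKrullDim A = d) {y : Fin d → A} (hy : ∀ i, y i ∈ 𝒜 1)
    (hQ : IsReduction 𝒜 (Ideal.span (Set.range y))) :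
    IsMinimalReduction 𝒜 (Ideal.span (Set.range y)) := by
  refine ⟨hQ, fun Q' hQ' hle => ?_⟩
  obtain ⟨⟨S, hS, rfl⟩, -⟩ := id hQ'
  obtain ⟨y', hy', hyS, hyQ⟩ := hA.exists_isReduction hd hS hQ'
  have hSy : Submodule.span k S ≤ Submodule.span k (Set.range y) :=
    Submodule.span_le.2 fun a ha =>
      mem_span_of_mem_ideal_span hA hy (hS ha) (hle (Ideal.subset_span ha))
  have hyS' : Submodule.span k (Set.range y') ≤ Submodule.span k S :=
    Submodule.span_le.2 (by rintro _ ⟨i, rfl⟩; exact hyS i)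
  have heq : Submodule.span k (Set.range y') = Submodule.span k (Set.range y) := by
    have := FiniteDimensional.span_of_finite k (Set.finite_range y)
    refine Submodule.eq_of_le_of_finrank_eq (hyS'.trans hSy) ?_
    rw [finrank_span_eq_card (hA.linearIndependent hd hy' hyQ),
      finrank_span_eq_card (hA.linearIndependent hd hy hQ)]
  rw [Ideal.span_le]
  rintro _ ⟨i, rfl⟩
  have : y i ∈ Submodule.span k (Set.range y') := heq ▸ Submodule.subset_span ⟨i, rfl⟩
  exact Submodule.span_le_restrictScalars k A _ (hyS' this)

end Graded

section MinorsOverField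

variable {K ρ γ : Type*} [Field K]

theorem exists_embedding_linearIndependent {V : Type*} [AddCommGroup V] [Module K V] [Finite ρ]
    {v : ρ → V} {t : ℕ} (ht : t ≤ Module.finrank K (Submodule.span K (Set.range v))) :
    ∃ e : Fin t ↪ ρ, LinearIndependent K (v ∘ e) := by
  obtain ⟨κ, a, ha, hspan, hli⟩ := exists_linearIndependent' K v
  have := Finite.of_injective a ha
  have := Fintype.ofFinite κ
  rw [← hspan, finrank_span_eq_card hli, ← Fintype.card_fin t] at ht
  obtain ⟨b⟩ := Function.Embedding.nonempty_of_card_le ht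
  exact ⟨b.trans ⟨a, ha⟩, hli.comp b b.injective⟩

theorem exists_minor_ne_zero [Finite ρ] [Fintype γ] {N : Matrix ρ γ K} {t : ℕ}
    (ht : t ≤ Module.finrank K (Submodule.span K (Set.range N))) :
    ∃ (e : Fin t ↪ ρ) (f : Fin t ↪ γ), (N.submatrix e f).det ≠ 0 := by
  obtain ⟨e, he⟩ := exists_embedding_linearIndependent ht
  have hrank : (N.submatrix e id).rank = t := by
    simpa using LinearIndependent.rank_matrix (M := N.submatrix e id) he
  obtain ⟨f, hf⟩ := exists_embedding_linearIndependent (t := t) (v := (N.submatrix e id).col)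
    (by rw [← Matrix.rank_eq_finrank_span_cols, hrank])
  refine ⟨e, f, ?_⟩
  have : IsUnit (N.submatrix e f) := Matrix.linearIndependent_cols_iff_isUnit.1 hf
  exact ((Matrix.isUnit_iff_isUnit_det _).1 this).ne_zero

theorem le_finrank_of_det_ne_zero [Finite γ] {W : Submodule K (γ → K)} {t : ℕ} {v : Fin t → γ → K}
    (hv : ∀ i, v i ∈ W) (f : Fin t → γ) (h : (Matrix.of fun i j => v i (f j)).det ≠ 0) :
    t ≤ Module.finrank K W := by
  have h1 := Matrix.linearIndependent_rows_of_det_ne_zero h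
  have h2 : LinearIndependent K v := LinearIndependent.of_comp (LinearMap.funLeft K K f) h1
  have h3 : LinearIndependent K fun i => (⟨v i, hv i⟩ : W) := LinearIndependent.of_comp W.subtype h2
  simpa using h3.fintype_card_le_finrank

theorem exists_minor_ne_zero_iff [Finite ρ] [Fintype γ] {N : Matrix ρ γ K} {t : ℕ} :
    (∃ (e : Fin t ↪ ρ) (f : Fin t ↪ γ), (N.submatrix e f).det ≠ 0) ↔
      t ≤ Module.finrank K (Submodule.span K (Set.range N)) :=
  ⟨fun ⟨e, f, h⟩ => le_finrank_of_det_ne_zero (v := N ∘ e)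
    (fun i => Submodule.subset_span ⟨e i, rfl⟩) f h, exists_minor_ne_zero⟩

end MinorsOverField

/-- Cramer's rule: if all minors obtained by adding the row `w` and one column to the square
submatrix with rows `e` and columns `f` vanish, then the determinant of that submatrix times `w`
is a combination of the rows `e`. -/
theorem exists_det_mul_eq_sum {R ρ γ : Type*} [CommRing R] (M : Matrix ρ γ R) (w : γ → R) {s : ℕ}
    (e : Fin s → ρ) (f : Fin s → γ)
    (h : ∀ c, (Matrix.of fun i j => (Fin.cons w (fun i => M (e i)) : Fin (s + 1) → γ → R) i
      ((Fin.cons c f : Fin (s + 1) → γ) j)).det = 0) :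
    ∃ a : Fin s → R, ∀ c, (M.submatrix e f).det * w c = ∑ i, a i * M (e i) c := by
  refine ⟨fun i => -((-1) ^ (i.succ : ℕ) * (Matrix.of fun i' j =>
    (Fin.cons w (fun i => M (e i)) : Fin (s + 1) → γ → R) (i.succ.succAbove i') (f j)).det),
    fun c => ?_⟩
  have := h c
  rw [Matrix.det_succ_column_zero, Fin.sum_univ_succ] at this
  simp only [Matrix.of_apply, Fin.cons_zero, Fin.cons_succ, Fin.val_zero, pow_zero, one_mul] at this
  have h0 : (Matrix.submatrix (Matrix.of fun i j =>
      (Fin.cons w (fun i => M (e i)) : Fin (s + 1) → γ → R) i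
        ((Fin.cons c f : Fin (s + 1) → γ) j)) (Fin.succAbove 0) Fin.succ) = M.submatrix e f := by
    ext i j
    simp
  rw [h0] at this
  rw [mul_comm, eq_neg_of_add_eq_zero_left this, ← Finset.sum_neg_distrib]
  refine Finset.sum_congr rfl fun i _ => ?_
  have h1 : (Matrix.submatrix (Matrix.of fun i j =>
      (Fin.cons w (fun i => M (e i)) : Fin (s + 1) → γ → R) i
        ((Fin.cons c f : Fin (s + 1) → γ) j)) (Fin.succAbove i.succ) Fin.succ) =
      Matrix.of fun i' j =>
        (Fin.cons w (fun i => M (e i)) : Fin (s + 1) → γ → R) (i.succ.succAbove i') (f j) := by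
    ext i' j
    simp
  rw [h1]
  ring

section Specialization

variable {k A : Type*} [Field k] [CommRing A] [Algebra k A]
  {𝒜 : ℕ → Submodule k A} {d m : ℕ} (x : Fin m → 𝒜 1) (B : DegreeBases 𝒜)

/-- The specialization `A[u] → A` at the point `α` with coordinates in `k`. -/
def specialize (α : Fin d × Fin m → k) : MvPolynomial (Fin d × Fin m) A →+* A :=
  eval fun p => algebraMap k A (α p)

@[simp]
theorem specialize_C (α : Fin d × Fin m → k) (a : A) : specialize α (C a) = a :=
  eval_C _

@[simp]
theorem specialize_map (α : Fin d × Fin m → k) (p : MvPolynomial (Fin d × Fin m) k) :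
    specialize α (MvPolynomial.map (algebraMap k A) p) = algebraMap k A (eval α p) := by
  rw [specialize, eval_map, eval₂_comp, Function.comp_def]

@[simp]
theorem specialize_genericForm (α : Fin d × Fin m → k) (i : Fin d) :
    specialize α (genericForm 𝒜 x i) = ∑ j, α (i, j) • (x j : A) := by
  simp [specialize, genericForm, Algebra.smul_def]

theorem specialForm_mem (α : Fin d × Fin m → k) (i : Fin d) :
    ∑ j, α (i, j) • (x j : A) ∈ 𝒜 1 :=
  Submodule.sum_mem _ fun j _ => Submodule.smul_mem _ _ (x j).2

/-- The vectors of coefficients, as forms of degree `n`. -/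
def formOfCoeffs (n : ℕ) : (Fin (Module.finrank k (𝒜 n)) → k) →ₗ[k] A :=
  (𝒜 n).subtype ∘ₗ (B n).equivFun.symm.toLinearMap

theorem formOfCoeffs_apply (n : ℕ) (w : Fin (Module.finrank k (𝒜 n)) → k) :
    formOfCoeffs B n w = ∑ c, w c • (B n c : A) := by
  simp [formOfCoeffs, Module.Basis.equivFun_symm_apply]

theorem formOfCoeffs_injective (n : ℕ) : Function.Injective (formOfCoeffs B n) :=
  Subtype.val_injective.comp (B n).equivFun.symm.injective

theorem formOfCoeffs_mem (n : ℕ) (w : Fin (Module.finrank k (𝒜 n)) → k) :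
    formOfCoeffs B n w ∈ 𝒜 n :=
  SetLike.coe_mem _

theorem exists_formOfCoeffs_eq {n : ℕ} {a : A} (ha : a ∈ 𝒜 n) : ∃ w, formOfCoeffs B n w = a :=
  ⟨(B n).equivFun ⟨a, ha⟩, by simp [formOfCoeffs]⟩

theorem specialize_mem {α : Fin d × Fin m → k} {F : MvPolynomial (Fin d × Fin m) A}
    (hF : F ∈ genericIdeal 𝒜 d x) : specialize α F ∈ specialIdeal 𝒜 x α := by
  have : genericIdeal 𝒜 d x ≤ (specialIdeal 𝒜 x α).comap (specialize α) := by
    rw [genericIdeal, Ideal.span_le]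
    rintro _ ⟨i, rfl⟩
    simp only [Ideal.coe_comap, Set.mem_preimage, specialize_genericForm, SetLike.mem_coe]
    exact Ideal.subset_span ⟨i, rfl⟩
  exact this hF

theorem exists_specialIdeal_eq (hx : Submodule.span k (Set.range x) = ⊤) {y : Fin d → A}
    (hy : ∀ i, y i ∈ 𝒜 1) :
    ∃ α : Fin d × Fin m → k, specialIdeal 𝒜 x α = Ideal.span (Set.range y) := by
  have : ∀ i, ∃ c : Fin m → k, ∑ j, c j • x j = (⟨y i, hy i⟩ : 𝒜 1) := fun i =>
    (Submodule.mem_span_range_iff_exists_fun k).1 (hx ▸ Submodule.mem_top)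
  choose c hc using this
  refine ⟨fun p => c p.1 p.2, ?_⟩
  rw [specialIdeal]
  congr 2
  ext i
  simpa using congrArg Subtype.val (hc i)

variable [GradedAlgebra 𝒜]

/-- The row space of the specialization of the matrix `M_{n+1}` at `α`. -/
def rowSpace (α : Fin d × Fin m → k) (n : ℕ) :
    Submodule k (Fin (Module.finrank k (𝒜 (n + 1))) → k) :=
  Submodule.span k (Set.range ((multMatrix 𝒜 d x B n).map (eval α)))

theorem formOfCoeffs_row (α : Fin d × Fin m → k) (n : ℕ)
    (ib : Fin d × Fin (Module.finrank k (𝒜 n))) :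
    formOfCoeffs B (n + 1) ((multMatrix 𝒜 d x B n).map (eval α) ib) =
      (∑ j, α (ib.1, j) • (x j : A)) * (B n ib.2 : A) := by
  have := congrArg (specialize α) (genericForm_mul_eq 𝒜 x B n ib.1 ib.2)
  simp only [map_mul, map_sum, specialize_genericForm, specialize_C, specialize_map] at this
  rw [this, formOfCoeffs_apply]
  simp [Algebra.smul_def]

theorem map_rowSpace (α : Fin d × Fin m → k) (n : ℕ) :
    (rowSpace x B α n).map (formOfCoeffs B (n + 1)) =
      (specialIdeal 𝒜 x α).restrictScalars k ⊓ 𝒜 (n + 1) := by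
  refine le_antisymm ?_ ?_
  · rw [rowSpace, Submodule.map_span_le]
    rintro _ ⟨ib, rfl⟩
    refine ⟨?_, formOfCoeffs_mem B _ _⟩
    rw [formOfCoeffs_row]
    exact Ideal.mul_mem_right _ _ (Ideal.subset_span ⟨ib.1, rfl⟩)
  · rintro a ⟨haQ, ha⟩
    obtain ⟨b, hb, rfl⟩ := exists_sum_mul_of_mem_span (specialForm_mem x α) ha haQ
    refine Submodule.sum_mem _ fun i _ => ?_
    obtain ⟨w, hw⟩ := exists_formOfCoeffs_eq B (hb i)
    rw [← hw, formOfCoeffs_apply, Finset.sum_mul]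
    refine Submodule.sum_mem _ fun c _ => ?_
    rw [smul_mul_assoc, mul_comm, ← formOfCoeffs_row x B α n (i, c)]
    exact Submodule.smul_mem _ _ (Submodule.mem_map_of_mem (Submodule.subset_span ⟨_, rfl⟩))

theorem mem_rowSpace_iff {α : Fin d × Fin m → k} {n : ℕ}
    {w : Fin (Module.finrank k (𝒜 (n + 1))) → k} :
    w ∈ rowSpace x B α n ↔ formOfCoeffs B (n + 1) w ∈ specialIdeal 𝒜 x α := by
  rw [← SetLike.mem_coe, ← (formOfCoeffs_injective B (n + 1)).mem_set_image,
    ← Submodule.map_coe, map_rowSpace]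
  exact ⟨fun h => h.1, fun h => ⟨h, formOfCoeffs_mem B _ _⟩⟩

theorem finrank_rowSpace (α : Fin d × Fin m → k) (n : ℕ) :
    Module.finrank k (rowSpace x B α n) = hilbertFunction 𝒜 (specialIdeal 𝒜 x α) (n + 1) := by
  rw [hilbertFunction, ← map_rowSpace x B]
  exact (Submodule.equivMapOfInjective _ (formOfCoeffs_injective B (n + 1)) _).finrank_eq

theorem mem_zeroLocus_minorsIdeal_iff {α : Fin d × Fin m → k} {n t : ℕ} :
    α ∈ zeroLocus k (minorsIdeal t (multMatrix 𝒜 d x B n)) ↔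
      hilbertFunction 𝒜 (specialIdeal 𝒜 x α) (n + 1) < t := by
  rw [← not_le, ← finrank_rowSpace x B, rowSpace, ← exists_minor_ne_zero_iff, minorsIdeal,
    zeroLocus_span]
  push Not
  refine ⟨fun h e f => ?_, ?_⟩
  · have := h _ ⟨e, f, rfl⟩
    rwa [aeval_eq_eval, RingHom.map_det] at this
  · rintro h _ ⟨e, f, rfl⟩
    rw [aeval_eq_eval, RingHom.map_det]
    exact h e f

theorem mem_parameterLocus_succ_iff (hA : IsStandardGraded 𝒜) {α : Fin d × Fin m → k} {n : ℕ} :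
    α ∈ parameterLocus 𝒜 d x B (n + 1) ↔
      ¬ 𝒜 (n + 1) ≤ (specialIdeal 𝒜 x α).restrictScalars k := by
  have := hA.finite (n + 1)
  rw [parameterLocus, mem_zeroLocus_minorsIdeal_iff, ← not_le, not_iff_not, hilbertFunction]
  refine ⟨fun h => ?_, fun h => ?_⟩
  · exact inf_eq_right.1 (Submodule.eq_of_le_of_finrank_le inf_le_right h)
  · rw [inf_eq_right.2 h]

theorem parameterLocus_succ_anti (hA : IsStandardGraded 𝒜) :
    Antitone fun n => parameterLocus 𝒜 d x B (n + 1) := by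
  intro n l hnl α hα
  simp only [mem_parameterLocus_succ_iff x B hA] at hα ⊢
  exact fun h => hα (hA.le_of_le (by omega) h)

theorem bddAbove_jumps (hA : IsStandardGraded 𝒜) :
    BddAbove {n | parameterLocus 𝒜 d x B n ≠ parameterLocus 𝒜 d x B (n + 1)} := by
  obtain ⟨N, hN⟩ := monotone_stabilizes_iff_noetherian.2
    (inferInstance : IsNoetherian (MvPolynomial (Fin d × Fin m) k) _)
    ⟨fun n => vanishingIdeal k (parameterLocus 𝒜 d x B (n + 1)),
      fun _ _ h => vanishingIdeal_anti_mono (parameterLocus_succ_anti x B hA h)⟩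
  have hV : ∀ n, parameterLocus 𝒜 d x B (n + 1) =
      zeroLocus k (vanishingIdeal k (parameterLocus 𝒜 d x B (n + 1))) := fun n =>
    ((zeroLocus_vanishingIdeal_galoisConnection (k := k) (K := k)).l_u_l_eq_l _).symm
  refine ⟨N, fun n hn => ?_⟩
  by_contra! hlt
  obtain ⟨n, rfl⟩ := Nat.exists_eq_succ_of_ne_zero (by omega : n ≠ 0)
  refine hn ?_
  rw [Nat.succ_eq_add_one, hV n, hV (n + 1)]
  exact congrArg _ ((hN n (by omega)).symm.trans (hN (n + 1) (by omega)))

theorem parameterLocus_eq_of_le (hA : IsStandardGraded 𝒜) {n : ℕ}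
    (hn : lastJump 𝒜 d x B + 1 ≤ n) :
    parameterLocus 𝒜 d x B n = parameterLocus 𝒜 d x B (lastJump 𝒜 d x B + 1) := by
  induction n, hn using Nat.le_induction with
  | base => rfl
  | succ n hn ih =>
    rw [← ih]
    by_contra h
    exact absurd (le_csSup (bddAbove_jumps x B hA) (Ne.symm h)) (by
      change ¬ n ≤ lastJump 𝒜 d x B
      omega)

/-- The complement of the zero locus of `J` consists of the points `α` such that `Q_α` is a
reduction. -/
theorem mem_zeroLocus_jumpIdeal_iff (hA : IsStandardGraded 𝒜) {α : Fin d × Fin m → k} :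
    α ∈ zeroLocus k (jumpIdeal 𝒜 d x B) ↔ ¬ IsReduction 𝒜 (specialIdeal 𝒜 x α) := by
  change α ∈ parameterLocus 𝒜 d x B (lastJump 𝒜 d x B + 1) ↔ _
  rw [specialIdeal, hA.isReduction_span_iff (by rintro _ ⟨i, rfl⟩; exact specialForm_mem x α i),
    ← specialIdeal]
  push Not
  constructor
  · intro h n hn
    rw [← parameterLocus_eq_of_le x B hA (n := lastJump 𝒜 d x B + 1 + n) (by omega),
      add_right_comm, mem_parameterLocus_succ_iff x B hA] at h
    exact h (hA.le_of_le (by omega) hn)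
  · intro h
    rw [mem_parameterLocus_succ_iff x B hA]
    exact h _

theorem core_eq_iInf_specialIdeal [Infinite k] (hA : IsStandardGraded 𝒜)
    (hd : ringKrullDim A = d) (hx : Submodule.span k (Set.range x) = ⊤) :
    core 𝒜 = ⨅ α : {α : Fin d × Fin m → k // IsReduction 𝒜 (specialIdeal 𝒜 x α)},
      specialIdeal 𝒜 x α.1 := by
  refine le_antisymm (le_iInf fun α => sInf_le α.2) (le_sInf fun Q hQ => ?_)
  obtain ⟨⟨S, hS, rfl⟩, -⟩ := id hQ
  obtain ⟨y, hy, hyS, hyQ⟩ := hA.exists_isReduction hd hS hQ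
  obtain ⟨α, hα⟩ := exists_specialIdeal_eq x hx hy
  refine (iInf_le _ ⟨α, hα ▸ hyQ⟩).trans ?_
  rw [hα, Ideal.span_le]
  rintro _ ⟨i, rfl⟩
  exact Submodule.span_le_restrictScalars k A _ (hyS i)

theorem exists_isReduction_specialIdeal [Infinite k] (hA : IsStandardGraded 𝒜)
    (hd : ringKrullDim A = d) (hx : Submodule.span k (Set.range x) = ⊤) :
    ∃ α : Fin d × Fin m → k, IsReduction 𝒜 (specialIdeal 𝒜 x α) := by
  obtain ⟨y, hy, -, hyQ⟩ := hA.exists_isReduction hd (S := 𝒜 1) le_rfl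
    ((hA.isReduction_span_iff le_rfl).2 ⟨1, fun a ha => Ideal.subset_span ha⟩)
  obtain ⟨α, hα⟩ := exists_specialIdeal_eq x hx hy
  exact ⟨α, hα ▸ hyQ⟩

theorem isHomogeneous_specialIdeal (α : Fin d × Fin m → k) :
    (specialIdeal 𝒜 x α).IsHomogeneous 𝒜 :=
  Ideal.homogeneous_span 𝒜 _ (by rintro _ ⟨i, rfl⟩; exact ⟨1, specialForm_mem x α i⟩)

theorem eq_zero_of_mem_specialIdeal {α : Fin d × Fin m → k} {a : A} (ha : a ∈ 𝒜 0)
    (haQ : a ∈ specialIdeal 𝒜 x α) : a = 0 := by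
  obtain ⟨c, hc⟩ := Ideal.mem_span_range_iff_exists_fun.1 haQ
  rw [← DirectSum.decompose_of_mem_same 𝒜 ha, ← hc, DirectSum.decompose_sum,
    DFinsupp.finsetSum_apply, AddSubmonoidClass.coe_finsetSum]
  exact Finset.sum_eq_zero fun i _ =>
    DirectSum.coe_decompose_mul_of_right_mem_of_not_le 𝒜 (specialForm_mem x α i) (by omega)

theorem C_mul_det_mem {n s : ℕ} {w : Fin (Module.finrank k (𝒜 (n + 1))) → k}
    {e : Fin s → Fin d × Fin (Module.finrank k (𝒜 n))}
    {f : Fin s → Fin (Module.finrank k (𝒜 (n + 1)))}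
    (h : ∀ c, (Matrix.of fun i j =>
      (Fin.cons (fun c => C (w c)) (fun i => multMatrix 𝒜 d x B n (e i)) :
        Fin (s + 1) → Fin (Module.finrank k (𝒜 (n + 1))) → MvPolynomial (Fin d × Fin m) k) i
        ((Fin.cons c f : Fin (s + 1) → Fin (Module.finrank k (𝒜 (n + 1)))) j)).det = 0) :
    C (formOfCoeffs B (n + 1) w) *
      MvPolynomial.map (algebraMap k A) ((multMatrix 𝒜 d x B n).submatrix e f).det ∈
        genericIdeal 𝒜 d x := by
  obtain ⟨a, ha⟩ := exists_det_mul_eq_sum _ _ e f h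
  have : C (formOfCoeffs B (n + 1) w) *
      MvPolynomial.map (algebraMap k A) ((multMatrix 𝒜 d x B n).submatrix e f).det =
      ∑ i, MvPolynomial.map (algebraMap k A) (a i) * C (B n (e i).2 : A) *
        genericForm 𝒜 x (e i).1 := by
    rw [formOfCoeffs_apply, map_sum, Finset.sum_mul]
    have h1 : ∀ c, C (w c • (B (n + 1) c : A)) *
        MvPolynomial.map (algebraMap k A) ((multMatrix 𝒜 d x B n).submatrix e f).det =
        ∑ i, MvPolynomial.map (algebraMap k A) (a i) *
          (MvPolynomial.map (algebraMap k A) (multMatrix 𝒜 d x B n (e i) c) *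
            C (B (n + 1) c : A)) := by
      intro c
      have h2 := congrArg (MvPolynomial.map (algebraMap k A)) (ha c)
      rw [map_mul, MvPolynomial.map_C, map_sum] at h2
      rw [Algebra.smul_def, C_mul, mul_right_comm, mul_comm (C _), h2, Finset.sum_mul]
      exact Finset.sum_congr rfl fun i _ => by rw [map_mul, mul_assoc]
    rw [Finset.sum_congr rfl fun c _ => h1 c, Finset.sum_comm]
    refine Finset.sum_congr rfl fun i _ => ?_
    rw [← Finset.mul_sum, ← genericForm_mul_eq, mul_comm (genericForm _ _ _), mul_assoc]
  rw [this]
  exact Submodule.sum_mem _ fun i _ => Ideal.mul_mem_left _ _ (Ideal.subset_span ⟨_, rfl⟩)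

/-- If the ideals `Q_α` have the same dimension in degree `n + 1` for all `α` outside the zero locus
of `J` and all of them contain the form `a` of degree `n + 1`, then `a J^N ⊆ Q_u` for some `N`. -/
theorem exists_C_mul_mem [IsAlgClosed k] (B : DegreeBases 𝒜) {J : Ideal (MvPolynomial (Fin d × Fin m) k)}
    {α₀ : Fin d × Fin m → k} (hα₀ : α₀ ∉ zeroLocus k J) {n s : ℕ}
    (hs : ∀ α ∉ zeroLocus k J, hilbertFunction 𝒜 (specialIdeal 𝒜 x α) (n + 1) = s)
    {a : A} (ha : a ∈ 𝒜 (n + 1)) (haQ : ∀ α ∉ zeroLocus k J, a ∈ specialIdeal 𝒜 x α) :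
    ∃ N : ℕ, ∀ g ∈ J ^ N, C a * MvPolynomial.map (algebraMap k A) g ∈ genericIdeal 𝒜 d x := by
  have : Infinite k := IsAlgClosed.instInfinite
  obtain ⟨w, rfl⟩ := exists_formOfCoeffs_eq B ha
  obtain ⟨g₀, hg₀, hg₀'⟩ : ∃ g ∈ J, aeval α₀ g ≠ 0 := by
    simpa using hα₀
  have hJ : J ≤ (minorsIdeal s (multMatrix 𝒜 d x B n)).radical := by
    rw [← vanishingIdeal_zeroLocus_eq_radical (K := k), ← le_zeroLocus_iff_le_vanishingIdeal]
    intro α hα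
    by_contra h
    rw [mem_zeroLocus_minorsIdeal_iff, hs α h] at hα
    exact lt_irrefl _ hα
  obtain ⟨N, hN⟩ := Ideal.exists_pow_le_of_le_radical_of_fg hJ (IsNoetherian.noetherian J)
  refine ⟨N, fun g hg => ?_⟩
  have key : minorsIdeal s (multMatrix 𝒜 d x B n) ≤
      ((genericIdeal 𝒜 d x).colon {C (formOfCoeffs B (n + 1) w)}).comap
        (MvPolynomial.map (algebraMap k A)) := by
    rw [minorsIdeal, Ideal.span_le]
    rintro _ ⟨e, f, rfl⟩
    simp only [Ideal.coe_comap, Set.mem_preimage, SetLike.mem_coe,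
      Submodule.mem_colon_singleton, smul_eq_mul]
    rw [mul_comm]
    refine C_mul_det_mem x B fun c => ?_
    set P := Matrix.of fun i j =>
      (Fin.cons (fun c => C (w c)) (fun i => multMatrix 𝒜 d x B n (e i)) :
        Fin (s + 1) → Fin (Module.finrank k (𝒜 (n + 1))) → MvPolynomial (Fin d × Fin m) k) i
        ((Fin.cons c f : Fin (s + 1) → Fin (Module.finrank k (𝒜 (n + 1)))) j) with hP
    have hP0 : ∀ α ∉ zeroLocus k J, eval α P.det = 0 := by
      intro α hα
      by_contra hne
      have h1 : s + 1 ≤ Module.finrank k (rowSpace x B α n) := by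
        refine le_finrank_of_det_ne_zero (v := Fin.cons w fun i =>
          (multMatrix 𝒜 d x B n).map (eval α) (e i)) ?_ (Fin.cons c f) ?_
        · refine Fin.cases ?_ fun i => ?_
          · exact (mem_rowSpace_iff x B).2 (haQ α hα)
          · exact Submodule.subset_span ⟨e i, rfl⟩
        · rw [RingHom.map_det] at hne
          convert hne using 2
          ext i j
          refine Fin.cases ?_ (fun i => ?_) i <;> simp [hP]
      rw [finrank_rowSpace, hs α hα] at h1
      omega
    have hmul : P.det * g₀ = 0 := by
      refine MvPolynomial.funext fun α => ?_
      rw [map_mul, map_zero]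
      by_cases hα : α ∈ zeroLocus k J
      · have : eval α g₀ = 0 := hα g₀ hg₀
        rw [this, mul_zero]
      · rw [hP0 α hα, zero_mul]
    refine (mul_eq_zero.1 hmul).resolve_right ?_
    rintro rfl
    exact hg₀' (map_zero _)
  have := key (hN hg)
  rwa [Ideal.mem_comap, Submodule.mem_colon_singleton, smul_eq_mul, mul_comm] at this

end Specialization

end GradedCore

end

theorem corollary1p9 {k A : Type*} [Field k] [IsAlgClosed k] [CommRing A] [Algebra k A]
    (𝒜 : ℕ → Submodule k A) [GradedAlgebra 𝒜] (hA : GradedCore.IsStandardGraded 𝒜)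
    (d : ℕ) (hd : ringKrullDim A = d)
    (m : ℕ) (x : Fin m → 𝒜 1) (hx : Submodule.span k (Set.range x) = ⊤)
    (B : GradedCore.DegreeBases 𝒜)
    (hH : ∀ α β : Fin d × Fin m → k,
      GradedCore.IsMinimalReduction 𝒜 (GradedCore.specialIdeal 𝒜 x α) →
      GradedCore.IsMinimalReduction 𝒜 (GradedCore.specialIdeal 𝒜 x β) →
      GradedCore.hilbertFunction 𝒜 (GradedCore.specialIdeal 𝒜 x α) =
        GradedCore.hilbertFunction 𝒜 (GradedCore.specialIdeal 𝒜 x β)) :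
    GradedCore.core 𝒜 =
      (GradedCore.colonInfty (GradedCore.genericIdeal 𝒜 d x)
        ((GradedCore.jumpIdeal 𝒜 d x B).map
          (MvPolynomial.map (algebraMap k A)))).comap
        (MvPolynomial.C : A →+* MvPolynomial (Fin d × Fin m) A) := by
  open GradedCore in
  classical
  have : Infinite k := IsAlgClosed.instInfinite
  have hU : ∀ {α : Fin d × Fin m → k}, α ∉ zeroLocus k (jumpIdeal 𝒜 d x B) ↔
      IsReduction 𝒜 (specialIdeal 𝒜 x α) := by
    intro α
    rw [mem_zeroLocus_jumpIdeal_iff x B hA, not_not]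
  have hmin : ∀ {α : Fin d × Fin m → k}, IsReduction 𝒜 (specialIdeal 𝒜 x α) →
      IsMinimalReduction 𝒜 (specialIdeal 𝒜 x α) := fun {α} h =>
    hA.isMinimalReduction hd (specialForm_mem x α) h
  obtain ⟨α₀, hα₀⟩ := exists_isReduction_specialIdeal x hA hd hx
  rw [core_eq_iInf_specialIdeal x hA hd hx]
  refine le_antisymm (fun a ha => ?_) (le_iInf fun α a ha => ?_)
  · rw [Ideal.mem_iInf] at ha
    rw [← DirectSum.sum_support_decompose 𝒜 a]
    refine Submodule.sum_mem _ fun n _ => ?_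
    have han : ∀ α, IsReduction 𝒜 (specialIdeal 𝒜 x α) →
        (DirectSum.decompose 𝒜 a n : A) ∈ specialIdeal 𝒜 x α := fun α hα =>
      isHomogeneous_specialIdeal x α n (ha ⟨α, hα⟩)
    generalize hb : DirectSum.decompose 𝒜 a n = b at han
    clear hb
    cases n with
    | zero =>
      rw [eq_zero_of_mem_specialIdeal x b.2 (han α₀ hα₀)]
      exact zero_mem _
    | succ n =>
      obtain ⟨N, hN⟩ := exists_C_mul_mem x B (hU.2 hα₀)
        (fun α hα => congrFun (hH α α₀ (hmin (hU.1 hα)) (hmin hα₀)) (n + 1)) b.2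
        (fun α hα => han α (hU.1 hα))
      refine ⟨N + 1, N.succ_pos, fun g hg => ?_⟩
      replace hg := Ideal.pow_le_pow_right N.le_succ hg
      rw [← Ideal.map_pow] at hg
      have key : ((jumpIdeal 𝒜 d x B) ^ N).map (MvPolynomial.map (algebraMap k A)) ≤
          (genericIdeal 𝒜 d x).colon {C (b : A)} := by
        rw [Ideal.map_le_iff_le_comap]
        intro g hg
        rw [Ideal.mem_comap, Submodule.mem_colon_singleton, smul_eq_mul, mul_comm]
        exact hN g hg
      have := key hg
      rwa [Submodule.mem_colon_singleton, smul_eq_mul, mul_comm] at this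
  · obtain ⟨N, -, hN⟩ := ha
    have hα := hU.2 α.2
    rw [mem_zeroLocus_iff] at hα
    push Not at hα
    obtain ⟨g, hg, hgα⟩ := hα
    have h1 := specialize_mem x (α := α.1) (hN _ (Ideal.pow_mem_pow (Ideal.mem_map_of_mem _ hg) N))
    rw [map_mul, map_pow, specialize_C, specialize_map, ← map_pow, mul_comm,
      ← Algebra.smul_def] at h1
    have hne : eval α.1 g ^ N ≠ 0 := pow_ne_zero _ hgα
    have h2 := ((specialIdeal 𝒜 x α.1).restrictScalars k).smul_mem (eval α.1 g ^ N)⁻¹ h1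
    rwa [smul_smul, inv_mul_cancel₀ hne, one_smul] at h2
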